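/- **Setting.** Fix a full conjunctive query $Q$ with $n\ge 1$ variables $x_1,\dots,x_n$ (in key order) and $m$ atoms; no atom repeats a variable, the arguments of each atom are listed consistently with the key order, and every variable occurs in some atom. An input $I$ gives each atom $A$ a finite relation $R_A$ of tuples of natural numbers (of the arity of $A$); $|I|$ is the total number of tuples, and a sub-input of $I$ replaces each relation by a subset. Relations are stored as TrieArrays, i.e. sorted tries whose levels are kept in value arrays and index arrays. The memory has $M$ words in blocks of $B\ge1$ words, with $\lfloor M/B\rfloor\ge nm$ (the query is small compared with the memory). *In-memory LFTJ.* Leapfrog Triejoin binds $x_1,\dots,x_n$ in this order; at each variable it runs the leapfrog join on the unary relations which the atoms mentioning this variable have below their current trie nodes, and continues recursively below every match. Its work $T_{\mathrm{mem}}(I)$ counts the trie-iterator operations, the steps of the leapfrog joins (one step per probe in `seek`, which is an exponential search followed by a binary search) and the output tuples. *Boxed LFTJ.* Each of the $n$ dimensions gets $\lfloor\lfloor M/B\rfloor/n\rfloor$ blocks, plus the blocks left unused by the previous dimensions. Recursively, at dimension $i$ the range of $x_i$ is cut into successive intervals $[\ell,h]$, starting with the least value as $\ell$; the available blocks are divided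 evenly (rounding down) among the atoms to be loaded there: those with first variable $x_i$, and those that have spilled and whose next unrestricted variable is $x_i$. Each of these atoms is probed, by binary search, for the maximal $h$ (possibly $\infty$) such that its slice with $x_i\in[\ell,h]$ (and with its spilled prefix) fits into its share. If no $h\ge\ell$ exists the atom spills. If some atom spills, $h$ is set to $\ell$, and the spilled atoms are restricted to $x_i=\ell$ and are left to the dimensions of their next variables; otherwise $h$ is the least of the probed bounds. The slices of the atoms that do not spill are loaded, dimension $i+1$ is processed recursively (after dimension $n$, in-memory LFTJ is run on all loaded slices, i.e. on one box), and the next interval starts at the successor of $h$, until $h=\infty$. The work $T_{\mathrm{box}}(I;B,M)$ counts the steps of all binary searches (at each guess of a probe, the size of the slice is found by as many look-ups as the atom has arguments), one step for each copied word of a loaded slice, a constant overhead per interval and per probe or load, and the work of all runs of in-memory LFTJ. For $N\ge1$ and an integer $c\ge1$ let $$T_{\mathrm{mem}}(N)=\sup\{T_{\mathrm{mem}}(I): |I|\le N\},\qquad T_{\mathrm{box},c}(N)=\sup\{T_{\mathrm{box}}(I;B,M): |I|\le N,\ |I|\le cM,\ B\ge 1,\ \lfloor M/B\rfloor\ge nm\}$$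 be the CPU data complexities of in-memory LFTJ, and of boxed LFTJ on inputs that are at most a constant factor $c$ larger than the memory. **Theorem.** For every such query $Q$ and every integer $c\ge1$ there is a constant $C$, depending only on $Q$ and $c$, such that: 1. for all $M$, $B\ge 1$ with $\lfloor M/B\rfloor\ge nm$ and every input $I$ with $|I|\le cM$ there is a sub-input $J$ of $I$ with $T_{\mathrm{box}}(I;B,M)\le C\cdot\max(T_{\mathrm{mem}}(J),|I|)$; 2. for all $N\ge1$, $$T_{\mathrm{box},c}(N)\le C\cdot\max(T_{\mathrm{mem}}(N),N)\quad\text{and}\quad \max(T_{\mathrm{mem}}(N),N)\le C\cdot T_{\mathrm{box},c}(N).$$ That is, the CPU data complexity of boxed LFTJ is $\Theta(\max(T_{\mathrm{mem}}(N),N))$: it matches that of in-memory LFTJ, or is linear in the size of the input, whichever is worse. -/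

import Mathlib

/-! ### Queries, inputs, tries -/

/-- A full conjunctive query with `m` atoms over the variables `x_0, …, x_{n-1}`, numbered in the
chosen key order.  `vars a` is the argument list of atom `a`: it is nonempty, no variable occurs
twice in it, and it is a subsequence of the key order.  Every variable occurs in some atom. -/
structure Query (n m : ℕ) where
  vars : Fin m → List (Fin n)
  vars_ne_nil : ∀ a, vars a ≠ []
  vars_sorted : ∀ a, (vars a).Pairwise (· < ·)
  covered : ∀ x, ∃ a, x ∈ vars a

/-- The number of arguments of an atom. -/
def Query.arity {n m : ℕ} (Q : Query n m) (a : Fin m) : ℕ := (Q.vars a).length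

/-- An input of a query: one finite relation (a set of tuples of atomic values) per atom. -/
structure Input {n m : ℕ} (Q : Query n m) where
  rel : Fin m → Finset (List ℕ)
  length_eq : ∀ a, ∀ t ∈ rel a, t.length = Q.arity a

/-- The size `|I|`: the total number of tuples. -/
def Input.size {n m : ℕ} {Q : Query n m} (I : Input Q) : ℕ := ∑ a, (I.rel a).card

/-- `J` is a sub-input of `I`: every relation of `J` is a subset of that of `I`. -/
def Input.IsSubinput {n m : ℕ} {Q : Query n m} (J I : Input Q) : Prop :=
  ∀ a, J.rel a ⊆ I.rel a

/-- The increasing array of the children of the root of the trie of `R`: the unary relation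
`R(x,_)` of the values in the first column. -/
def children (R : Finset (List ℕ)) : List ℕ := (R.image (fun t => t.headD 0)).sort (· ≤ ·)

/-- The sub-trie `R_v` below the child `v` of the root of the trie of `R`. -/
def subtrie (R : Finset (List ℕ)) (v : ℕ) : Finset (List ℕ) :=
  (R.filter (fun t => t.head? = some v)).image List.tail

/-! ### Searching in sorted arrays

Every algorithm below returns its result together with the number of steps it performs. -/

/-- Binary search for the first index of `[lo, hi)` at which the monotone test `p` succeeds (`hi`
if there is none); one step per test. -/
def binSearch (p : ℕ → Bool) (lo hi : ℕ) : ℕ × ℕ :=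
  if lo < hi then
    let mid := (lo + hi) / 2
    if p mid then
      let r := binSearch p lo mid
      (r.1, r.2 + 1)
    else
      let r := binSearch p (mid + 1) hi
      (r.1, r.2 + 1)
  else (lo, 0)
termination_by hi - lo

/-- Exponential search for the first index `< len` at which the monotone test `p` succeeds (`len`
if there is none).  The indices `4 ^ k, 4 ^ (k + 1), …` are tested until one succeeds or is out of
range, and a binary search between the last two follows; the answer is known to be `≥ lo`. -/
def gallop (p : ℕ → Bool) (len lo k : ℕ) : ℕ × ℕ :=
  if 4 ^ k < len ∧ p (4 ^ k) = false then
    let r := gallop p len (4 ^ k + 1) (k + 1)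
    (r.1, r.2 + 1)
  else
    let r := binSearch p lo (min (4 ^ k) len)
    (r.1, r.2 + 1)
termination_by len - 4 ^ k
decreasing_by
  rename_i h
  have h4 : 4 ^ k < 4 ^ (k + 1) := Nat.pow_lt_pow_right (by norm_num) (Nat.lt_succ_self k)
  omega

/-! ### Leapfrog join and Leapfrog Triejoin

A linear iterator over a unary relation is represented by the increasing list of the elements from
its current position on: `value` is the head, `next` the tail, and `atEnd` means `[]`. -/

/-- `seek`: forward-position an iterator whose value is `< v` to the first value `≥ v`. -/
def seek (xs : List ℕ) (v : ℕ) : List ℕ × ℕ :=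
  let r := gallop (fun i => decide (v ≤ xs.getD i 0)) xs.length 1 0
  (xs.drop r.1, r.2)

/-- The main loop of the leapfrog join, from after the initialization until the join is at its end,
calling `lfj-next` after each match.  The iterators are listed in cyclic order starting with
`Iters[i]`, so that the last one is `Iters[i - 1]`, which holds the largest value.  Returned are the
matches and the number of steps.  Each round moves an iterator forward, so that the fuel used in
`leapfrog` (the total number of remaining elements plus one) does not run out. -/
def leapfrogLoop : ℕ → List (List ℕ) → List ℕ × ℕ
  | 0, _ => ([], 0)
  | _ + 1, [] => ([], 1)
  | fuel + 1, it :: rest =>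
    match (rest.getLastD it).head?, it with
    | none, _ => ([], 1)
    | some _, [] => ([], 1)
    | some maxValue, minValue :: tl =>
      if minValue = maxValue then
        let r := leapfrogLoop fuel (rest ++ [tl])
        (maxValue :: r.1, r.2 + 1)
      else
        let s := seek it maxValue
        let r := leapfrogLoop fuel (rest ++ [s.1])
        (r.1, r.2 + s.2 + 1)

/-- Leapfrog join: the intersection of the given unary relations, in increasing order.  With `k`
relations, the initialization is charged `k` steps for the tests of `atEnd` and `k ^ 2` steps for
the sorting of the iterators. -/
def leapfrog (its : List (List ℕ)) : List ℕ × ℕ :=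
  if its.any List.isEmpty then ([], its.length)
  else
    let r := leapfrogLoop ((its.map List.length).sum + 1)
      (its.mergeSort (fun a b => decide (a.headD 0 ≤ b.headD 0)))
    (r.1, its.length + its.length ^ 2 + r.2)

/-- Leapfrog Triejoin.  The first argument lists the variables that are still to be bound, the
second one holds for every atom its unbound variables and the sub-trie below the current position
of its trie iterator.  For the next variable `x`, the iterators of the atoms that mention `x` are
opened (one step each), the leapfrog join of their unary relations is computed, below each match `v`
the search continues with the next variable, and the iterators are closed (one step each).  Every
output tuple takes one step. -/
def lftj {n : ℕ} : List (Fin n) → List (List (Fin n) × Finset (List ℕ)) → List (List ℕ) × ℕ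
  | [], _ => ([[]], 1)
  | x :: xs, cs =>
    let its := (cs.filter (fun c => c.1.head? = some x)).map (fun c => children c.2)
    let r := leapfrog its
    let below := r.1.map (fun v => (v, lftj xs
      (cs.map (fun c => if c.1.head? = some x then (c.1.tail, subtrie c.2 v) else c))))
    (below.flatMap (fun b => b.2.1.map (fun t => b.1 :: t)),
      2 * its.length + r.2 + (below.map (fun b => b.2.2)).sum)

/-- In-memory Leapfrog Triejoin for the query `Q`, run on the relations `R`. -/
def runLFTJ {n m : ℕ} (Q : Query n m) (R : Fin m → Finset (List ℕ)) : List (List ℕ) × ℕ :=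
  lftj (List.finRange n) ((List.finRange m).map (fun a => (Q.vars a, R a)))

/-! ### Slices, probing and provisioning -/

/-- The slice of `R` for the start tuple `s` from `l` to `h`, at level `k = s.length`: the tuples
of `R` that begin with `s` and whose entry number `k` is in `[l, h]`. -/
def slice (R : Finset (List ℕ)) (s : List ℕ) (l : ℕ) (h : WithTop ℕ) : Finset (List ℕ) :=
  R.filter (fun t => t.take s.length = s ∧ l ≤ t.getD s.length 0 ∧
    ((t.getD s.length 0 : ℕ) : WithTop ℕ) ≤ h)

/-- The number of nodes at level `j` of the trie of `S`, i.e. the length of its value array `j`. -/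
def trieNodes (S : Finset (List ℕ)) (j : ℕ) : ℕ := (S.image (fun t => t.take (j + 1))).card

/-- The number of words that a slice `S` at level `k` of a relation of arity `r` occupies: the value
arrays `k, …, r - 1`, and the index arrays `k, …, r - 2`, each with one entry per node and one entry
for the end. -/
def sliceWords (r k : ℕ) (S : Finset (List ℕ)) : ℕ :=
  if S = ∅ then 0
  else ∑ j ∈ Finset.Ico k r, trieNodes S j + ∑ j ∈ Finset.Ico k (r - 1), (trieNodes S j + 1)

/-- The number of blocks of `B` words that a slice occupies. -/
def sliceBlocks (B r k : ℕ) (S : Finset (List ℕ)) : ℕ := (sliceWords r k S + B - 1) / B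

/-- Locate the prefix `s` in the trie of `R` by one binary search per entry of `s`; returns the
sub-trie below it. -/
def locate : Finset (List ℕ) → List ℕ → Finset (List ℕ) × ℕ
  | R, [] => (R, 0)
  | R, v :: s =>
    let vs := children R
    let f := binSearch (fun i => decide (v ≤ vs.getD i 0)) 0 vs.length
    let q := locate (subtrie R v) s
    (q.1, f.2 + q.2)

/-- Probe the relation `R` of arity `r` from the start tuple `s` and the lower bound `l` for a
memory budget of `budget` blocks of `B` words: the maximal `h ≥ l` (possibly `⊤`) such that the
slice from `l` to `h` occupies at most `budget` blocks, or `none` (a spill) if there is no such `h`.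
After the prefix and the lower bound have been located, this is a binary search in the value array
at level `s.length`; the size of the slice at each guess is found by `r` look-ups. -/
def probe (B r : ℕ) (R : Finset (List ℕ)) (s : List ℕ) (l budget : ℕ) :
    Option (WithTop ℕ) × ℕ :=
  let loc := locate R s
  let vs := children loc.1
  let lo := binSearch (fun i => decide (l ≤ vs.getD i 0)) 0 vs.length
  let hi := binSearch (fun i => decide
    (budget < sliceBlocks B r s.length (slice R s l ((vs.getD i 0 : ℕ) : WithTop ℕ)))) lo.1 vs.length
  (if hi.1 < vs.length then
      let v := vs.getD hi.1 0
      if l < v then some ((v - 1 : ℕ) : WithTop ℕ) else none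
    else some ⊤,
    1 + loc.2 + lo.2 + r * hi.2)

/-- The number of steps for provisioning a slice: the prefix and the two bounds are located by
binary searches, and the words of the slice are copied one by one. -/
def provisionSteps (r : ℕ) (R : Finset (List ℕ)) (s : List ℕ) (l : ℕ) (h : WithTop ℕ) : ℕ :=
  let loc := locate R s
  let vs := children loc.1
  let lo := binSearch (fun i => decide (l ≤ vs.getD i 0)) 0 vs.length
  let hi := binSearch (fun i => decide (h < ((vs.getD i 0 : ℕ) : WithTop ℕ))) 0 vs.length
  1 + loc.2 + lo.2 + hi.2 + sliceWords r s.length (slice R s l h)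

/-! ### Boxed Leapfrog Triejoin -/

/-- For every atom: the slice that is provisioned for it (`none` as long as there is none), and the
start tuple to which it has been restricted by the spills so far. -/
structure BoxState (m : ℕ) where
  start : Fin m → List ℕ
  prov : Fin m → Option (Finset (List ℕ))

/-- The atoms to be provisioned at the dimension `x`: the atoms with first variable `x`, and the
spilled atoms whose next unrestricted variable is `x`. -/
def activeAtoms {n m : ℕ} (Q : Query n m) (st : BoxState m) (x : Fin n) : List (Fin m) :=
  (List.finRange m).filter
    (fun a => (st.prov a).isNone && decide ((Q.vars a)[(st.start a).length]? = some x))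

/-- The repeat-until loop of the boxing procedure at one dimension.  `body l` handles the interval
with lower bound `l`, and returns its upper bound, the output and the number of steps.  The loop ends
when the upper bound is `⊤`, and continues from the successor of the upper bound otherwise. -/
def boxLoop (body : ℕ → WithTop ℕ × List (List ℕ) × ℕ) : ℕ → ℕ → List (List ℕ) × ℕ
  | 0, _ => ([], 0)
  | fuel + 1, l =>
    let r := body l
    match r.1 with
    | none => r.2
    | some h =>
      let q := boxLoop body fuel (h + 1)
      (r.2.1 ++ q.1, r.2.2 + q.2)

/-- The largest value that occurs in the relations. -/
def maxValue {m : ℕ} (R : Fin m → Finset (List ℕ)) : ℕ :=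
  Finset.univ.sup (fun a => (R a).sup (fun t => t.foldr max 0))

/-- The recursive procedure of boxed Leapfrog Triejoin.  `xs` lists the dimensions that are still to
be handled, `budget` is the number of blocks of memory reserved for each dimension, `leftover` the
number of blocks left unused by the previous dimensions.

At the dimension `x`, the search space is cut into intervals `[l, high]`, beginning with the least
value as lower bound.  The memory is divided evenly among the atoms to be provisioned at `x`, and
each of them is probed.  If some atom spills, then `high = l`; the spilled atoms are restricted to
the value `l` of `x` and left to the dimensions of their next variables.  Otherwise `high` is the
least of the probed bounds.  The atoms that do not spill are provisioned from `l` to `high`, the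
next dimensions are handled recursively, and the next interval begins at the successor of `high`.
When no dimension is left, in-memory Leapfrog Triejoin is run on the provisioned slices.

The lower bounds increase, and a lower bound that exceeds all values gives `high = ⊤`, so that
`maxValue R + 2` rounds are enough. -/
def boxUp {n m : ℕ} (Q : Query n m) (R : Fin m → Finset (List ℕ)) (B budget : ℕ) :
    List (Fin n) → ℕ → BoxState m → List (List ℕ) × ℕ
  | [], _, st => runLFTJ Q (fun a => (st.prov a).getD ∅)
  | x :: xs, leftover, st =>
    boxLoop (fun l =>
      let mem := budget + leftover
      let atms := activeAtoms Q st x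
      let bound : Fin m → Option (WithTop ℕ) × ℕ := fun a =>
        probe B (Q.arity a) (R a) (st.start a) l (mem / atms.length)
      let spilled := atms.filter (fun a => (bound a).1.isNone)
      let loaded := atms.filter (fun a => (bound a).1.isSome)
      let high : WithTop ℕ :=
        if spilled = [] then (loaded.map (fun a => (bound a).1.getD ⊤)).foldr min ⊤
        else (l : WithTop ℕ)
      let S : Fin m → Finset (List ℕ) := fun a => slice (R a) (st.start a) l high
      let used := (loaded.map
        (fun a => sliceBlocks B (Q.arity a) (st.start a).length (S a))).sum
      let st' : BoxState m :=
        { start := fun a => if a ∈ spilled then st.start a ++ [l] else st.start a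
          prov := fun a => if a ∈ loaded then some (S a) else st.prov a }
      let r := boxUp Q R B budget xs (mem - used) st'
      (high, r.1,
        1 + (atms.map (fun a => (bound a).2)).sum
          + (loaded.map (fun a => provisionSteps (Q.arity a) (R a) (st.start a) l high)).sum
          + r.2))
      (maxValue R + 2) 0

/-- Boxed Leapfrog Triejoin for the query `Q` on the relations `R`, with a memory of `M` words in
blocks of `B` words.  The `M / B` blocks are divided evenly among the `n` dimensions. -/
def runBoxedLFTJ {n m : ℕ} (Q : Query n m) (B M : ℕ) (R : Fin m → Finset (List ℕ)) :
    List (List ℕ) × ℕ :=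
  boxUp Q R B (M / B / n) (List.finRange n) 0 { start := fun _ => [], prov := fun _ => none }

/-! ### CPU complexity -/

/-- The CPU work of in-memory Leapfrog Triejoin on the input `I`. -/
def inMemorySteps {n m : ℕ} {Q : Query n m} (I : Input Q) : ℕ := (runLFTJ Q I.rel).2

/-- The CPU work of boxed Leapfrog Triejoin on the input `I`. -/
def boxedSteps {n m : ℕ} {Q : Query n m} (B M : ℕ) (I : Input Q) : ℕ :=
  (runBoxedLFTJ Q B M I.rel).2

/-- The memory of `M` words in blocks of `B ≥ 1` words is large in comparison with the query: it
has a block for every pair of a dimension and an atom. -/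
def LargeMemory (n m B M : ℕ) : Prop := 0 < B ∧ n * m ≤ M / B

/-- The CPU data complexity of in-memory Leapfrog Triejoin for the query `Q`: the worst case over
all inputs of size at most `N`. -/
noncomputable def inMemoryComplexity {n m : ℕ} (Q : Query n m) (N : ℕ) : ℕ∞ :=
  ⨆ I : {I : Input Q // I.size ≤ N}, (inMemorySteps I.1 : ℕ∞)

/-- The CPU data complexity of boxed Leapfrog Triejoin for the query `Q` on inputs that are at most
`c` times larger than the memory: the worst case over all memories (of `p.2.2` words in blocks of
`p.2.1` words) and all such inputs `p.1` of size at most `N`. -/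
noncomputable def boxedComplexity {n m : ℕ} (Q : Query n m) (c N : ℕ) : ℕ∞ :=
  ⨆ p : {p : Input Q × ℕ × ℕ //
      p.1.size ≤ N ∧ LargeMemory n m p.2.1 p.2.2 ∧ p.1.size ≤ c * p.2.2},
    (boxedSteps p.1.2.1 p.1.2.2 p.1.1 : ℕ∞)

/-! ### Searching -/

/-! Upper bound: when the input is at most `c` times the memory, every dimension is cut into
boundedly many intervals, so there are boundedly many boxes. An interval ends at a finite `h` only
because some atom overflows its share once its slice is extended to `h + 1` (`exists_large_slice`).
A slice takes at most `3 * n` words per tuple, so that extended slice has more than `share * B / (3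
* n)` tuples. The extension may overlap the next interval, but not the one after it. Hence the
number of remaining tuples drops by a fixed fraction of the memory over any two consecutive
intervals (`boxLoop_steps_le`), and `memory_le_share` makes the number of intervals depend only on
`n`, `m` and `c`. Probing and loading cost O(|I|) per interval; even a linear bound on each binary
search is enough. Every box runs in-memory LFTJ on a sub-input of `I`. With `J` the costliest of the
finitely many sub-inputs, induction over the dimensions (`boxUp_steps_le`) gives O(max(T_mem(J),
|I|)). Lower bound: with `B = 1` and enough memory there is a single box, so boxed LFTJ performs the
whole in-memory run and also copies every relation (`le_boxUp_steps`). The first cost dominates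
T_mem(N); the second, on one relation with `N` tuples, dominates `N`. -/

theorem binSearch_steps_le (p : ℕ → Bool) (lo hi : ℕ) : (binSearch p lo hi).2 ≤ hi - lo := by
  induction lo, hi using binSearch.induct (p := p) with
  | case1 lo hi h mid hp ih => rw [binSearch]; simp [h, mid, hp]; grind
  | case2 lo hi h mid hp ih => rw [binSearch]; simp [h, mid, hp]; grind
  | case3 lo hi h => rw [binSearch]; simp [h]

theorem binSearch_le (p : ℕ → Bool) {lo hi : ℕ} (hle : lo ≤ hi) : (binSearch p lo hi).1 ≤ hi := by
  induction lo, hi using binSearch.induct (p := p) with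
  | case1 lo hi h mid hp ih => rw [binSearch]; simp [h, mid, hp]; grind
  | case2 lo hi h mid hp ih => rw [binSearch]; simp [h, mid, hp]; grind
  | case3 lo hi h => rw [binSearch]; simpa [h] using hle

/-- Holds without monotonicity of `p`: a returned index below `hi` has itself been tested
successfully. The analysis of probing needs no more than this. -/
theorem binSearch_spec (p : ℕ → Bool) (lo hi : ℕ) (h : (binSearch p lo hi).1 < hi) :
    p (binSearch p lo hi).1 = true := by
  induction lo, hi using binSearch.induct (p := p) with
  | case1 lo hi hlt mid hp ih =>
    rw [binSearch] at h ⊢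
    simp only [hlt, mid, hp, if_true] at h ⊢
    by_cases hm : (binSearch p lo ((lo + hi) / 2)).1 < (lo + hi) / 2
    · exact ih hm
    · have := binSearch_le p (show lo ≤ (lo + hi) / 2 by omega)
      rw [show (binSearch p lo ((lo + hi) / 2)).1 = (lo + hi) / 2 by omega]
      exact hp
  | case2 lo hi hlt mid hp ih =>
    rw [binSearch] at h ⊢
    simp only [hlt, mid, hp, if_true] at h ⊢
    exact ih h
  | case3 lo hi hlt =>
    rw [binSearch] at h
    simp [hlt] at h

/-! ### Sizes of tries and slices -/

theorem length_children_le (R : Finset (List ℕ)) : (children R).length ≤ R.card := by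
  simpa [children] using Finset.card_image_le

theorem card_subtrie_le (R : Finset (List ℕ)) (v : ℕ) : (subtrie R v).card ≤ R.card :=
  Finset.card_image_le.trans (Finset.card_filter_le _ _)

theorem card_locate_le (R : Finset (List ℕ)) (s : List ℕ) : (locate R s).1.card ≤ R.card := by
  induction s generalizing R with
  | nil => simp [locate]
  | cons v s ih => simpa [locate] using (ih _).trans (card_subtrie_le R v)

theorem locate_steps_le (R : Finset (List ℕ)) (s : List ℕ) :
    (locate R s).2 ≤ s.length * R.card := by
  induction s generalizing R with
  | nil => simp [locate]
  | cons v s ih =>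
    have h1 := binSearch_steps_le (fun i => decide (v ≤ (children R).getD i 0)) 0
      (children R).length
    have h2 := length_children_le R
    have h3 := (ih (subtrie R v)).trans (Nat.mul_le_mul_left _ (card_subtrie_le R v))
    simp only [locate, List.length_cons, add_mul, one_mul]
    omega

theorem slice_subset (R : Finset (List ℕ)) (s : List ℕ) (l : ℕ) (h : WithTop ℕ) :
    slice R s l h ⊆ R := Finset.filter_subset _ _

theorem slice_nil_zero_top (R : Finset (List ℕ)) : slice R [] 0 ⊤ = R := by
  simp [slice]

theorem slice_mono (R : Finset (List ℕ)) (s : List ℕ) {l l' : ℕ} {h h' : WithTop ℕ}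
    (hl : l' ≤ l) (hh : h ≤ h') : slice R s l h ⊆ slice R s l' h' :=
  Finset.monotone_filter_right _ fun _ _ ⟨h1, h2, h3⟩ => ⟨h1, hl.trans h2, h3.trans hh⟩

theorem card_slice_add_card_slice_le (R : Finset (List ℕ)) (s : List ℕ) {l h : ℕ} (hlh : l ≤ h) :
    (slice R s (h + 1) ⊤).card + (slice R s l h).card ≤ (slice R s l ⊤).card := by
  rw [← Finset.card_union_of_disjoint]
  · exact Finset.card_le_card (Finset.union_subset
      (slice_mono R s (by omega) le_rfl) (slice_mono R s le_rfl le_top))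
  · rw [Finset.disjoint_left]
    intro t h1 h2
    simp only [slice, Finset.mem_filter, Nat.cast_le] at h1 h2
    omega

/-- Each level has at most one node per tuple; the end entry of an index array is absorbed by a
second tuple count, as `S` is nonempty. This makes one value entry and two index entries per level
and tuple. -/
theorem sliceWords_le (r k : ℕ) (S : Finset (List ℕ)) : sliceWords r k S ≤ 3 * r * S.card := by
  unfold sliceWords
  split_ifs with hS
  · simp
  have hc : 1 ≤ S.card := Finset.card_pos.2 (Finset.nonempty_iff_ne_empty.2 hS)
  have hn : ∀ j, trieNodes S j ≤ S.card := fun j => Finset.card_image_le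
  have h1 := Finset.sum_le_card_nsmul (Finset.Ico k r) (trieNodes S) _ fun j _ => hn j
  have h2 := Finset.sum_le_card_nsmul (Finset.Ico k (r - 1)) (fun j => trieNodes S j + 1)
    (S.card + S.card) fun j _ => add_le_add (hn j) hc
  simp only [Nat.card_Ico, smul_eq_mul] at h1 h2
  have h3 : (r - k) * S.card ≤ r * S.card := Nat.mul_le_mul_right _ (by omega)
  have h4 : (r - 1 - k) * (S.card + S.card) ≤ r * (S.card + S.card) :=
    Nat.mul_le_mul_right _ (by omega)
  linarith

/-- The nodes of the last trie level are the tuples themselves. -/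
theorem card_le_sliceWords {r : ℕ} (hr : 0 < r) {S : Finset (List ℕ)}
    (hS : ∀ t ∈ S, t.length = r) : S.card ≤ sliceWords r 0 S := by
  unfold sliceWords
  split_ifs with h
  · simp [h]
  have h1 : trieNodes S (r - 1) = S.card := by
    refine Finset.card_image_of_injOn fun t ht u hu htu => ?_
    have e : ∀ t ∈ S, t.take (r - 1 + 1) = t := fun t ht =>
      List.take_of_length_le (by rw [hS t ht]; omega)
    simpa only [e t ht, e u hu] using htu
  have h2 : trieNodes S (r - 1) ≤ ∑ j ∈ Finset.Ico 0 r, trieNodes S j :=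
    Finset.single_le_sum (f := trieNodes S) (fun _ _ => Nat.zero_le _)
      (Finset.mem_Ico.2 ⟨Nat.zero_le _, by omega⟩)
  omega

theorem mul_lt_sliceWords_of_lt_sliceBlocks {B r k b : ℕ} (hB : 0 < B) {S : Finset (List ℕ)}
    (h : b < sliceBlocks B r k S) : b * B < sliceWords r k S := by
  unfold sliceBlocks at h
  have := (Nat.le_div_iff_mul_le hB).1 (Nat.succ_le_of_lt h)
  rw [Nat.succ_mul] at this
  omega

/-! ### Probing and provisioning -/

/-- The second alternative concerns an empty slice and never occurs. Keeping it avoids proving that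
the search result lies at or beyond `l`, and it is harmless later because slices grow with their
upper bound. -/
theorem probe_eq_none {B r : ℕ} {R : Finset (List ℕ)} {s : List ℕ} {l b : ℕ}
    (h : (probe B r R s l b).1 = none) : b < sliceBlocks B r s.length (slice R s l l) ∨
      ∃ v < l, b < sliceBlocks B r s.length (slice R s l (v : ℕ)) := by
  unfold probe at h
  simp only at h
  split_ifs at h with h1 h2
  have h3 := binSearch_spec _ _ _ h1
  simp only [decide_eq_true_eq] at h3
  rcases (not_lt.1 h2).eq_or_lt with h4 | h4
  · left; rwa [h4] at h3
  · exact Or.inr ⟨_, h4, h3⟩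

theorem probe_eq_coe {B r : ℕ} {R : Finset (List ℕ)} {s : List ℕ} {l b h : ℕ}
    (hp : (probe B r R s l b).1 = some (h : WithTop ℕ)) :
    l ≤ h ∧ b < sliceBlocks B r s.length (slice R s l (h + 1 : ℕ)) := by
  unfold probe at hp
  simp only at hp
  split_ifs at hp with h1 h2
  · have h3 := binSearch_spec _ _ _ h1
    simp only [decide_eq_true_eq] at h3
    have h4 := Nat.cast_injective (R := WithTop ℕ) (Option.some_injective _ hp)
    rw [← h4]
    refine ⟨by omega, ?_⟩
    rwa [Nat.sub_add_cancel (by omega)]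
  · exact absurd (Option.some_injective _ hp) (WithTop.coe_ne_top (a := h)).symm

theorem probe_eq_top {B r : ℕ} {R : Finset (List ℕ)} {s : List ℕ} {l b : ℕ}
    (hb : ∀ h, sliceBlocks B r s.length (slice R s l h) ≤ b) :
    (probe B r R s l b).1 = some ⊤ := by
  unfold probe
  simp only
  split_ifs with h1 h2
  · have h3 := binSearch_spec _ _ _ h1
    simp only [decide_eq_true_eq] at h3
    exact absurd h3 (not_lt.2 (hb _))
  · have h3 := binSearch_spec _ _ _ h1
    simp only [decide_eq_true_eq] at h3
    exact absurd h3 (not_lt.2 (hb _))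
  · rfl

theorem probe_steps_le (B r : ℕ) (R : Finset (List ℕ)) (s : List ℕ) (l b : ℕ) :
    (probe B r R s l b).2 ≤ 1 + (s.length + 1 + r) * R.card := by
  unfold probe
  have h1 := locate_steps_le R s
  have h2 := (length_children_le (locate R s).1).trans (card_locate_le R s)
  simp only
  generalize (children (locate R s).1) = vs at *
  have h3 := binSearch_steps_le (fun i => decide (l ≤ vs.getD i 0)) 0 vs.length
  generalize (binSearch (fun i => decide (l ≤ vs.getD i 0)) 0 vs.length) = lo at *
  have h4 := binSearch_steps_le (fun i => decide
    (b < sliceBlocks B r s.length (slice R s l ((vs.getD i 0 : ℕ) : WithTop ℕ)))) lo.1 vs.length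
  have h5 := Nat.mul_le_mul_left r (h4.trans ((Nat.sub_le _ _).trans h2))
  linarith [h3.trans ((Nat.sub_le _ _).trans h2)]

theorem provisionSteps_le (r : ℕ) (R : Finset (List ℕ)) (s : List ℕ) (l : ℕ) (h : WithTop ℕ) :
    provisionSteps r R s l h ≤ 1 + (s.length + 2 + 3 * r) * R.card := by
  unfold provisionSteps
  have h1 := locate_steps_le R s
  have h2 := (length_children_le (locate R s).1).trans (card_locate_le R s)
  simp only
  generalize (children (locate R s).1) = vs at *
  have h3 := binSearch_steps_le (fun i => decide (l ≤ vs.getD i 0)) 0 vs.length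
  have h4 := binSearch_steps_le (fun i => decide (h < ((vs.getD i 0 : ℕ) : WithTop ℕ))) 0 vs.length
  have h5 := (sliceWords_le r s.length (slice R s l h)).trans
    (Nat.mul_le_mul_left _ (Finset.card_le_card (slice_subset R s l h)))
  linarith [h3.trans ((Nat.sub_le _ _).trans h2), h4.trans ((Nat.sub_le _ _).trans h2)]

/-! ### The loop at one dimension -/

theorem boxLoop_of_eq_top {body : ℕ → WithTop ℕ × List (List ℕ) × ℕ} {l : ℕ}
    (h : (body l).1 = ⊤) (fuel : ℕ) : boxLoop body (fuel + 1) l = (body l).2 := by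
  have h' : (body l).1 = none := h
  simp only [boxLoop, h']

theorem boxLoop_of_eq_coe {body : ℕ → WithTop ℕ × List (List ℕ) × ℕ} {l h : ℕ}
    (hb : (body l).1 = h) (fuel : ℕ) :
    (boxLoop body (fuel + 1) l).2 = (body l).2.2 + (boxLoop body fuel (h + 1)).2 := by
  have h' : (body l).1 = some h := hb
  simp only [boxLoop, h']

/-- If a potential drops by at least `T` over any two consecutive intervals, then the number of
rounds of the loop is at most `2 * q + 1`, where `q * T` bounds the initial potential. -/
theorem boxLoop_steps_le {body : ℕ → WithTop ℕ × List (List ℕ) × ℕ} {D T : ℕ} {Φ : ℕ → ℕ}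
    (hD : ∀ l, (body l).2.2 ≤ D) (hΦ : Antitone Φ)
    (hstep : ∀ l h : ℕ, (body l).1 = h → l ≤ h ∧ Φ (h + 2) + T < Φ l)
    (fuel l q : ℕ) (hq : Φ l ≤ q * T) : (boxLoop body fuel l).2 ≤ (2 * q + 1) * D := by
  induction q generalizing fuel l with
  | zero =>
    cases fuel with
    | zero => simp [boxLoop]
    | succ fuel =>
      cases hb : (body l).1 using WithTop.recTopCoe with
      | top => rw [boxLoop_of_eq_top hb]; simpa using hD l
      -- The initial potential is zero and cannot drop strictly, so a bounded interval is
      -- impossible.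
      | coe h => have := (hstep l h hb).2; omega
  | succ q ih =>
    cases fuel with
    | zero => simp [boxLoop]
    | succ fuel =>
      have hl := hD l
      cases hb : (body l).1 using WithTop.recTopCoe with
      | top => rw [boxLoop_of_eq_top hb]; nlinarith
      | coe h =>
        rw [boxLoop_of_eq_coe hb]
        obtain ⟨-, hlt⟩ := hstep l h hb
        have hl' := hD (h + 1)
        cases fuel with
        | zero => simp only [boxLoop]; nlinarith
        | succ fuel =>
          cases hb' : (body (h + 1)).1 using WithTop.recTopCoe with
          | top => rw [boxLoop_of_eq_top hb']; nlinarith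
          | coe h' =>
            rw [boxLoop_of_eq_coe hb']
            -- The second interval starts at `h + 1` and ends at some `h' ≥ h + 1`, so the third
            -- starts at `h + 2` or later; two rounds are paid for by one drop.
            have h1 := hΦ (show h + 2 ≤ h' + 1 by have := (hstep _ _ hb').1; omega)
            have := ih fuel (h' + 1) (by rw [add_mul] at hq; omega)
            nlinarith

/-! ### A single interval: its named ingredients, its overflow and its cost. -/

section BoxedRound

variable {n m : ℕ} (Q : Query n m) (R : Fin m → Finset (List ℕ)) (B mem : ℕ) (x : Fin n)
  (st : BoxState m) (l : ℕ)

/-- The number of blocks available to each atom to be provisioned at the dimension `x`. -/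
def memoryShare : ℕ := mem / (activeAtoms Q st x).length

/-- The result of probing the atom `a` from the lower bound `l`. -/
def atomBound (a : Fin m) : Option (WithTop ℕ) × ℕ :=
  probe B (Q.arity a) (R a) (st.start a) l (memoryShare Q mem x st)

/-- The atoms that spill at the lower bound `l`. -/
def spilledAtoms : List (Fin m) :=
  (activeAtoms Q st x).filter (fun a => (atomBound Q R B mem x st l a).1.isNone)

/-- The atoms that are provisioned at the lower bound `l`. -/
def loadedAtoms : List (Fin m) :=
  (activeAtoms Q st x).filter (fun a => (atomBound Q R B mem x st l a).1.isSome)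

/-- The upper bound of the interval with lower bound `l`. -/
def intervalEnd : WithTop ℕ :=
  if spilledAtoms Q R B mem x st l = [] then
    ((loadedAtoms Q R B mem x st l).map
      (fun a => (atomBound Q R B mem x st l a).1.getD ⊤)).foldr min ⊤
  else (l : WithTop ℕ)

/-- The slice of the atom `a` for the interval with lower bound `l`. -/
def intervalSlice (a : Fin m) : Finset (List ℕ) :=
  slice (R a) (st.start a) l (intervalEnd Q R B mem x st l)

/-- The state in which the next dimension is processed. -/
def nextState : BoxState m :=
  { start := fun a => if a ∈ spilledAtoms Q R B mem x st l then st.start a ++ [l] else st.start a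
    prov := fun a => if a ∈ loadedAtoms Q R B mem x st l then
      some (intervalSlice Q R B mem x st l a) else st.prov a }

/-- The number of blocks used by the slices provisioned for one interval. -/
def usedBlocks : ℕ :=
  ((loadedAtoms Q R B mem x st l).map (fun a => sliceBlocks B (Q.arity a) (st.start a).length
    (intervalSlice Q R B mem x st l a))).sum

/-- The steps for probing and provisioning in one interval. -/
def roundSteps : ℕ :=
  1 + ((activeAtoms Q st x).map (fun a => (atomBound Q R B mem x st l a).2)).sum
    + ((loadedAtoms Q R B mem x st l).map (fun a => provisionSteps (Q.arity a) (R a) (st.start a) l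
        (intervalEnd Q R B mem x st l))).sum

/-- One round of the loop at the dimension `x`, where `rest` processes the following dimensions. -/
def boxRound (rest : ℕ → BoxState m → List (List ℕ) × ℕ) : WithTop ℕ × List (List ℕ) × ℕ :=
  let r := rest (mem - usedBlocks Q R B mem x st l) (nextState Q R B mem x st l)
  (intervalEnd Q R B mem x st l, r.1, roundSteps Q R B mem x st l + r.2)

theorem boxUp_cons (budget leftover : ℕ) (xs : List (Fin n)) :
    boxUp Q R B budget (x :: xs) leftover st =
      boxLoop (fun l => boxRound Q R B (budget + leftover) x st l (boxUp Q R B budget xs))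
        (maxValue R + 2) 0 := rfl

theorem length_activeAtoms_le : (activeAtoms Q st x).length ≤ m :=
  (List.length_filter_le _ _).trans (by simp)

variable {Q R B mem x st l}

theorem mem_activeAtoms {a : Fin m} : a ∈ activeAtoms Q st x ↔
    st.prov a = none ∧ (Q.vars a)[(st.start a).length]? = some x := by
  simp [activeAtoms]

theorem mem_spilledAtoms {a : Fin m} : a ∈ spilledAtoms Q R B mem x st l ↔
    a ∈ activeAtoms Q st x ∧ (atomBound Q R B mem x st l a).1 = none := by
  simp [spilledAtoms]

theorem mem_loadedAtoms {a : Fin m} : a ∈ loadedAtoms Q R B mem x st l ↔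
    a ∈ activeAtoms Q st x ∧ (atomBound Q R B mem x st l a).1.isSome = true := by
  simp [loadedAtoms]

theorem Query.arity_le (Q : Query n m) (a : Fin m) : Q.arity a ≤ n := by
  have h : (Q.vars a).Nodup := (Q.vars_sorted a).imp fun h => h.ne
  simpa [Query.arity] using h.length_le_card

theorem foldr_min_top_eq_coe {L : List (WithTop ℕ)} {h : ℕ} (hL : L.foldr min ⊤ = h) :
    (h : WithTop ℕ) ∈ L := by
  induction L with
  | nil => exact absurd hL.symm (WithTop.coe_ne_top (a := h))
  | cons b L ih =>
    rw [List.foldr_cons] at hL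
    rcases min_choice b (L.foldr min ⊤) with h1 | h1
    · rw [h1] at hL; simp [hL]
    · rw [h1] at hL; exact List.mem_cons_of_mem _ (ih hL)

/-- If an interval is bounded, then some atom to be provisioned does not fit into its share up to
the successor of the upper bound. -/
theorem exists_large_slice (hB : 0 < B) {h : ℕ} (hh : intervalEnd Q R B mem x st l = h) :
    l ≤ h ∧ ∃ a ∈ activeAtoms Q st x,
      memoryShare Q mem x st * B < 3 * n * (slice (R a) (st.start a) l (h + 1 : ℕ)).card := by
  -- A spill overflows already at `l = h`, a probed bound only at `h + 1`; by monotonicity both are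
  -- overflows at `h + 1`.
  have key : ∀ a ∈ activeAtoms Q st x, ∀ v : ℕ, v ≤ h + 1 → memoryShare Q mem x st <
      sliceBlocks B (Q.arity a) (st.start a).length (slice (R a) (st.start a) l v) →
      ∃ a ∈ activeAtoms Q st x,
      memoryShare Q mem x st * B < 3 * n * (slice (R a) (st.start a) l (h + 1 : ℕ)).card := by
    intro a ha v hv hlt
    refine ⟨a, ha, (mul_lt_sliceWords_of_lt_sliceBlocks hB hlt).trans_le
      ((sliceWords_le _ _ _).trans ?_)⟩
    gcongr
    · exact Q.arity_le a
    · exact slice_mono _ _ le_rfl (by exact_mod_cast hv)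
  unfold intervalEnd at hh
  split_ifs at hh with hs
  · obtain ⟨a, ha, hah⟩ := List.mem_map.1 (foldr_min_top_eq_coe hh)
    obtain ⟨ha1, ha2⟩ := mem_loadedAtoms.1 ha
    obtain ⟨y, hy⟩ := Option.isSome_iff_exists.1 ha2
    rw [hy, Option.getD_some] at hah
    rw [hah] at hy
    obtain ⟨h1, h2⟩ := probe_eq_coe hy
    exact ⟨h1, key a ha1 _ le_rfl h2⟩
  · have hl : l = h := WithTop.coe_injective hh
    obtain ⟨a, ha⟩ := List.exists_mem_of_ne_nil _ hs
    obtain ⟨ha1, ha2⟩ := mem_spilledAtoms.1 ha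
    refine ⟨hl.le, ?_⟩
    rcases probe_eq_none ha2 with h1 | ⟨v, hv, h1⟩
    · exact key a ha1 l (by omega) h1
    · exact key a ha1 v (by omega) h1

/-- An active atom still has an unrestricted variable, so its start tuple is shorter than its arity;
hence the coefficients of the probing and loading costs depend on `n` alone. -/
theorem roundSteps_le {N : ℕ} (hN : ∀ a, (R a).card ≤ N) :
    roundSteps Q R B mem x st l ≤ 1 + m * (2 + (6 * n + 3) * N) := by
  have hk : ∀ a ∈ activeAtoms Q st x, (st.start a).length ≤ n := fun a ha =>
    ((List.getElem?_eq_some_iff.1 (mem_activeAtoms.1 ha).2).1.le).trans (Q.arity_le a)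
  have h1 : ((activeAtoms Q st x).map (fun a => (atomBound Q R B mem x st l a).2)).sum ≤
      m * (1 + (2 * n + 1) * N) := by
    refine (List.sum_le_card_nsmul _ (1 + (2 * n + 1) * N) ?_).trans ?_
    · simp only [List.mem_map]
      rintro _ ⟨a, ha, rfl⟩
      have h1 := hk a ha
      have h2 := Q.arity_le a
      exact (probe_steps_le _ _ _ _ _ _).trans
        (Nat.add_le_add_left (Nat.mul_le_mul (by omega) (hN a)) 1)
    · rw [smul_eq_mul, List.length_map]
      exact Nat.mul_le_mul_right _ (length_activeAtoms_le Q x st)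
  have h2 : ((loadedAtoms Q R B mem x st l).map (fun a => provisionSteps (Q.arity a) (R a)
      (st.start a) l (intervalEnd Q R B mem x st l))).sum ≤ m * (1 + (4 * n + 2) * N) := by
    refine (List.sum_le_card_nsmul _ (1 + (4 * n + 2) * N) ?_).trans ?_
    · simp only [List.mem_map]
      rintro _ ⟨a, ha, rfl⟩
      have h1 := hk a (mem_loadedAtoms.1 ha).1
      have h2 := Q.arity_le a
      exact (provisionSteps_le _ _ _ _ _).trans
        (Nat.add_le_add_left (Nat.mul_le_mul (by omega) (hN a)) 1)
    · rw [smul_eq_mul, List.length_map]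
      exact Nat.mul_le_mul_right _
        ((List.length_filter_le _ _).trans (length_activeAtoms_le Q x st))
  unfold roundSteps
  calc _ ≤ 1 + m * (1 + (2 * n + 1) * N) + m * (1 + (4 * n + 2) * N) := by gcongr
    _ = _ := by ring

theorem nextState_prov_subset (hst : ∀ a S, st.prov a = some S → S ⊆ R a) (a : Fin m)
    (S : Finset (List ℕ)) (hS : (nextState Q R B mem x st l).prov a = some S) : S ⊆ R a := by
  simp only [nextState] at hS
  split_ifs at hS with h
  · exact Option.some_injective _ hS ▸ slice_subset _ _ _ _
  · exact hst a S hS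

/-! ### Upper bound -/

/-- The number of tuples that remain from the lower bound `l` on. -/
def remaining (R : Fin m → Finset (List ℕ)) (st : BoxState m) (l : ℕ) : ℕ :=
  ∑ a, (slice (R a) (st.start a) l ⊤).card

theorem remaining_antitone (R : Fin m → Finset (List ℕ)) (st : BoxState m) :
    Antitone (remaining R st) := fun _ _ h =>
  Finset.sum_le_sum fun _ _ => Finset.card_le_card (slice_mono _ _ h le_rfl)

theorem remaining_add_card_slice_le (R : Fin m → Finset (List ℕ)) (st : BoxState m) {l h : ℕ}
    (hlh : l ≤ h) (a : Fin m) :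
    remaining R st (h + 1) + (slice (R a) (st.start a) l h).card ≤ remaining R st l := by
  have h1 : (slice (R a) (st.start a) l h).card ≤ ∑ a, (slice (R a) (st.start a) l h).card :=
    Finset.single_le_sum (f := fun a => (slice (R a) (st.start a) l h).card)
      (fun _ _ => Nat.zero_le _) (Finset.mem_univ a)
  refine (Nat.add_le_add_left h1 _).trans ?_
  unfold remaining
  rw [← Finset.sum_add_distrib]
  exact Finset.sum_le_sum fun a _ => card_slice_add_card_slice_le _ _ hlh

/-- The factor in the bound on the steps of boxed Leapfrog Triejoin with `k` dimensions left. -/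
def boxFactor (n m q : ℕ) : ℕ → ℕ
  | 0 => 1
  | k + 1 => (2 * q + 1) * (1 + m * (2 + (6 * n + 3)) + boxFactor n m q k)

theorem boxUp_steps_le {budget share q N W : ℕ} (hB : 0 < B)
    (hshare : share ≤ budget / m) (hW : 1 ≤ W) (hNW : N ≤ W)
    (hN : ∑ a, (R a).card ≤ N) (hq : 3 * n * N ≤ q * (share * B))
    (hmem : ∀ R' : Fin m → Finset (List ℕ), (∀ a, R' a ⊆ R a) → (runLFTJ Q R').2 ≤ W)
    (xs : List (Fin n)) (leftover : ℕ) (st : BoxState m)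
    (hst : ∀ a S, st.prov a = some S → S ⊆ R a) :
    (boxUp Q R B budget xs leftover st).2 ≤ boxFactor n m q xs.length * W := by
  induction xs generalizing leftover st with
  | nil =>
    simp only [boxUp, boxFactor, List.length_nil, one_mul]
    refine hmem _ fun a => ?_
    cases h : st.prov a with
    | none => simp
    | some S => simpa using hst a S h
  | cons x xs ih =>
    rw [boxUp_cons, List.length_cons, boxFactor, mul_assoc]
    have hR : ∀ a, (R a).card ≤ N := fun a =>
      (Finset.single_le_sum (f := fun a => (R a).card) (fun _ _ => Nat.zero_le _)
        (Finset.mem_univ a)).trans hN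
    -- The potential is measured in words: `3 * n` per remaining tuple, against the `share * B`
    -- words guaranteed to each atom.
    refine boxLoop_steps_le (T := share * B) (Φ := fun l => 3 * n * remaining R st l) ?_ ?_ ?_
      _ _ _ ?_
    · intro l
      have h1 := roundSteps_le (Q := Q) (B := B) (mem := budget + leftover) (x := x) (st := st)
        (l := l) hR
      have h2 := ih (budget + leftover - usedBlocks Q R B (budget + leftover) x st l)
        (nextState Q R B (budget + leftover) x st l) (nextState_prov_subset hst)
      have h3 : 1 + m * (2 + (6 * n + 3) * N) ≤ (1 + m * (2 + (6 * n + 3))) * W := by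
        calc 1 + m * (2 + (6 * n + 3) * N) ≤ W + m * (2 * W + (6 * n + 3) * W) := by
              gcongr; omega
          _ = _ := by ring
      rw [add_mul]
      exact add_le_add (h1.trans h3) h2
    · exact fun _ _ h => Nat.mul_le_mul_left _ (remaining_antitone R st h)
    · intro l h hh
      obtain ⟨hlh, a, ha, hlt⟩ := exists_large_slice hB hh
      refine ⟨hlh, ?_⟩
      -- At most `m` atoms compete, and leftover blocks only enlarge the shares.
      have hs : share ≤ memoryShare Q (budget + leftover) x st :=
        hshare.trans ((Nat.div_le_div_left (length_activeAtoms_le Q x st)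
          (List.length_pos_of_mem ha)).trans (Nat.div_le_div_right (Nat.le_add_right _ _)))
      have h1 := (Nat.mul_le_mul_right B hs).trans_lt hlt
      have h2 := Nat.mul_le_mul_left (3 * n)
        (remaining_add_card_slice_le R st (show l ≤ h + 1 by omega) a)
      rw [mul_add] at h2
      exact (Nat.add_lt_add_left h1 _).trans_le h2
    · refine (Nat.mul_le_mul_left _ ((Finset.sum_le_sum fun a _ =>
        Finset.card_le_card (slice_subset _ _ _ _)).trans hN)).trans hq

/-- Lets the constant overhead per interval be absorbed into max(T_mem(J), |I|) even for an empty
input. -/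
theorem runLFTJ_steps_pos (Q : Query n m) (R : Fin m → Finset (List ℕ)) :
    1 ≤ (runLFTJ Q R).2 := by
  unfold runLFTJ
  generalize (List.finRange m).map (fun a => (Q.vars a, R a)) = cs
  cases List.finRange n with
  | nil => simp [lftj]
  | cons x xs =>
    simp only [lftj]
    generalize (cs.filter (fun c => c.1.head? = some x)).map (fun c => children c.2) = its
    cases its with
    | nil => simp [leapfrog, leapfrogLoop]
    | cons a its => simp only [List.length_cons]; omega

/-- Rounding down loses only a constant factor, because `LargeMemory` makes each share at least one
block. -/
theorem memory_le_share {n m B M : ℕ} (hnm : 0 < n * m) (h : LargeMemory n m B M) :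
    M ≤ 4 * (n * m) * (M / B / (n * m) * B) := by
  obtain ⟨hB, h⟩ := h
  have h1 : M < B * (M / B + 1) := Nat.lt_mul_div_succ M hB
  have h2 : M / B < n * m * (M / B / (n * m) + 1) := Nat.lt_mul_div_succ _ hnm
  have h3 : 1 ≤ M / B / (n * m) := (Nat.one_le_div_iff hnm).2 h
  generalize M / B / (n * m) = s at *
  generalize M / B = p at *
  generalize n * m = k at *
  have h4 : p + 1 ≤ k * (2 * s) := h2.trans_le (Nat.mul_le_mul_left _ (by omega))
  calc M ≤ B * (p + 1) := h1.le
    _ ≤ B * (k * (2 * s)) := Nat.mul_le_mul_left _ h4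
    _ ≤ 4 * k * (s * B) := by nlinarith [Nat.zero_le (B * k * s)]

/-- There are finitely many sub-inputs, so one maximizes the in-memory work. No monotonicity of that
work in the input is required. -/
theorem exists_subinput_forall_steps_le {Q : Query n m} (I : Input Q) :
    ∃ J : Input Q, J.IsSubinput I ∧
      ∀ R : Fin m → Finset (List ℕ), (∀ a, R a ⊆ I.rel a) → (runLFTJ Q R).2 ≤ inMemorySteps J := by
  obtain ⟨R₀, h1, h2⟩ := Finset.exists_max_image
    (Fintype.piFinset fun a => (I.rel a).powerset) (fun R => (runLFTJ Q R).2)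
    ⟨I.rel, by simp⟩
  simp only [Fintype.mem_piFinset, Finset.mem_powerset] at h1 h2
  exact ⟨⟨R₀, fun a t ht => I.length_eq a t (h1 a ht)⟩, h1, h2⟩

theorem exists_boxedSteps_le (Q : Query n m) (c : ℕ) :
    ∃ C : ℕ, ∀ (B M : ℕ) (I : Input Q), LargeMemory n m B M → I.size ≤ c * M →
      ∃ J : Input Q, J.IsSubinput I ∧
        boxedSteps B M I ≤ C * max (inMemorySteps J) I.size := by
  -- The argument `q` is the number of shares that cover the potential: `3 * n` words per tuple, `c
  -- * M` tuples, and `M` at most `4 * (n * m)` shares.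
  refine ⟨boxFactor n m (3 * n * c * (4 * (n * m))) n, fun B M I hM hI => ?_⟩
  obtain ⟨J, hJ, hmax⟩ := exists_subinput_forall_steps_le I
  refine ⟨J, hJ, ?_⟩
  have h := boxUp_steps_le (Q := Q) (R := I.rel) (B := B) (budget := M / B / n)
    (share := M / B / n / m) (q := 3 * n * c * (4 * (n * m))) (N := I.size)
    (W := max (inMemorySteps J) I.size) hM.1 le_rfl
    (le_max_of_le_left (runLFTJ_steps_pos Q J.rel)) (le_max_right _ _) le_rfl ?_
    (fun R' hR' => (hmax R' hR').trans (le_max_left _ _)) (List.finRange n) 0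
    { start := fun _ => [], prov := fun _ => none } (by simp)
  · simpa [boxedSteps, runBoxedLFTJ] using h
  rcases Nat.eq_zero_or_pos (n * m) with h0 | hpos
  · rcases Nat.mul_eq_zero.1 h0 with rfl | rfl
    · simp
    · simp [Input.size]
  have h1 := memory_le_share hpos hM
  rw [Nat.div_div_eq_div_mul]
  calc 3 * n * I.size ≤ 3 * n * (c * M) := Nat.mul_le_mul_left _ hI
    _ ≤ 3 * n * (c * (4 * (n * m) * (M / B / (n * m) * B))) := by gcongr
    _ = _ := by ring

/-! ### Lower bound -/

/-- With enough memory, all atoms are provisioned completely, and there is a single box. -/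
theorem le_boxUp_steps {budget L : ℕ} (hbudget : m * L ≤ budget)
    (hL : ∀ a, 3 * Q.arity a * (R a).card ≤ L)
    (hlen : ∀ a, ∀ t ∈ R a, t.length = Q.arity a)
    (xs : List (Fin n)) (leftover : ℕ) (st : BoxState m) (hstart : ∀ a, st.start a = [])
    (hprov : ∀ a, st.prov a = some (R a) ∨ st.prov a = none ∧ ∃ x ∈ xs, (Q.vars a)[0]? = some x) :
    (runLFTJ Q R).2 ≤ (boxUp Q R 1 budget xs leftover st).2 ∧
      ∀ a, st.prov a = none → (R a).card ≤ (boxUp Q R 1 budget xs leftover st).2 := by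
  induction xs generalizing leftover st with
  | nil =>
    have h : ∀ a, st.prov a = some (R a) := fun a => by simpa using hprov a
    simp [boxUp, h]
  | cons x xs ih =>
    have hbound : ∀ a ∈ activeAtoms Q st x,
        (atomBound Q R 1 (budget + leftover) x st 0 a).1 = some ⊤ := by
      intro a ha
      refine probe_eq_top fun h => ?_
      have h1 : L ≤ memoryShare Q (budget + leftover) x st := by
        refine (Nat.le_div_iff_mul_le (List.length_pos_of_mem ha)).2 ?_
        calc L * _ ≤ L * m := Nat.mul_le_mul_left _ (length_activeAtoms_le Q x st)
          _ ≤ budget + leftover := by linarith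
      have h2 := (sliceWords_le (Q.arity a) (st.start a).length
        (slice (R a) (st.start a) 0 h)).trans
        (Nat.mul_le_mul_left _ (Finset.card_le_card (slice_subset (R a) (st.start a) 0 h)))
      -- With `B = 1`, blocks are words.
      simpa [sliceBlocks] using (h2.trans (hL a)).trans h1
    have hsp : spilledAtoms Q R 1 (budget + leftover) x st 0 = [] :=
      List.filter_eq_nil_iff.2 fun a ha => by simp [hbound a ha]
    have hld : loadedAtoms Q R 1 (budget + leftover) x st 0 = activeAtoms Q st x :=
      List.filter_eq_self.2 fun a ha => by simp [hbound a ha]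
    have hend : intervalEnd Q R 1 (budget + leftover) x st 0 = ⊤ := by
      unfold intervalEnd
      rw [if_pos hsp, hld]
      cases hh : ((activeAtoms Q st x).map (fun a =>
        (atomBound Q R 1 (budget + leftover) x st 0 a).1.getD ⊤)).foldr min ⊤
          using WithTop.recTopCoe with
      | top => rfl
      | coe h =>
        obtain ⟨a, ha, hah⟩ := List.mem_map.1 (foldr_min_top_eq_coe hh)
        rw [hbound a ha] at hah
        exact absurd hah.symm (WithTop.coe_ne_top (a := h))
    have hslice : ∀ a, intervalSlice Q R 1 (budget + leftover) x st 0 a = R a := fun a => by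
      rw [intervalSlice, hend, hstart, slice_nil_zero_top]
    have hnext : ∀ a, (nextState Q R 1 (budget + leftover) x st 0).prov a =
        if a ∈ activeAtoms Q st x then some (R a) else st.prov a := fun a => by
      simp only [nextState, hld, hslice]
    rw [boxUp_cons, boxLoop_of_eq_top (by exact hend)]
    obtain ⟨ih1, ih2⟩ := ih
      (budget + leftover - usedBlocks Q R 1 (budget + leftover) x st 0)
      (nextState Q R 1 (budget + leftover) x st 0)
      (fun a => by simp [nextState, hsp, hstart])
      (fun a => by
        rw [hnext]
        split_ifs with ha
        · exact Or.inl rfl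
        -- An unloaded atom that is not active at `x` has its first variable among the later
        -- dimensions.
        · refine (hprov a).imp_right fun ⟨h1, y, hy, hay⟩ => ⟨h1, y, ?_, hay⟩
          refine (List.mem_cons.1 hy).resolve_left fun hyx => ha ?_
          rw [mem_activeAtoms, hstart]
          exact ⟨h1, hyx ▸ hay⟩)
    refine ⟨ih1.trans (Nat.le_add_left _ _), fun a ha => ?_⟩
    by_cases hact : a ∈ activeAtoms Q st x
    -- Here `a` is loaded in this round, and copying its words already costs its cardinality.
    · refine le_trans ?_ (Nat.le_add_right _ _)
      refine le_trans ?_ (Nat.le_add_left _ _)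
      refine le_trans ?_ (List.single_le_sum (by simp) _ (List.mem_map.2 ⟨a, hld ▸ hact, rfl⟩))
      have h1 := card_le_sliceWords (List.length_pos_of_ne_nil (Q.vars_ne_nil a)) (hlen a)
      simp only [provisionSteps, hend, hstart, slice_nil_zero_top, List.length_nil]
      exact h1.trans (Nat.le_add_left _ _)
    · refine (ih2 a ?_).trans (Nat.le_add_left _ _)
      rw [hnext, if_neg hact, ha]

theorem exists_le_boxedSteps (hn : 0 < n) {Q : Query n m} {c : ℕ} (hc : 0 < c) (I : Input Q) :
    ∃ M, LargeMemory n m 1 M ∧ I.size ≤ c * M ∧ inMemorySteps I ≤ boxedSteps 1 M I ∧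
      ∀ a, (I.rel a).card ≤ boxedSteps 1 M I := by
  have hm : 0 < m := Fin.pos (Q.covered ⟨0, hn⟩).choose
  have hcard : ∀ a, (I.rel a).card ≤ I.size := fun a =>
    Finset.single_le_sum (f := fun a => (I.rel a).card) (fun _ _ => Nat.zero_le _)
      (Finset.mem_univ a)
  -- Room in words for any one relation; the `+ 1` keeps the memory large enough when `I` is empty.
  set L := 3 * n * I.size + 1 with hLdef
  refine ⟨n * (m * L), ⟨one_pos, ?_⟩, ?_, ?_⟩
  · rw [Nat.div_one, ← mul_assoc]
    exact Nat.le_mul_of_pos_right _ (by omega)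
  · calc I.size ≤ n * I.size := Nat.le_mul_of_pos_left _ hn
      _ ≤ L := by rw [hLdef]; nlinarith [Nat.zero_le (n * I.size)]
      _ ≤ m * L := Nat.le_mul_of_pos_left _ hm
      _ ≤ n * (m * L) := Nat.le_mul_of_pos_left _ hn
      _ ≤ c * (n * (m * L)) := Nat.le_mul_of_pos_left _ hc
  · have h := le_boxUp_steps (Q := Q) (R := I.rel) (budget := n * (m * L) / 1 / n) (L := L)
      (by rw [Nat.div_one, Nat.mul_div_cancel_left _ hn])
      (fun a => (Nat.mul_le_mul (Nat.mul_le_mul_left 3 (Q.arity_le a)) (hcard a)).trans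
        (Nat.le_succ _))
      I.length_eq (List.finRange n) 0 { start := fun _ => [], prov := fun _ => none }
      (fun _ => rfl)
      (fun a => Or.inr ⟨rfl, _, List.mem_finRange _,
        List.getElem?_eq_getElem (List.length_pos_of_ne_nil (Q.vars_ne_nil a))⟩)
    exact ⟨h.1, fun a => h.2 a rfl⟩

/-- The input whose relation for the atom `a` consists of the first `N` constant tuples, while all
other relations are empty. -/
def diagonalInput (Q : Query n m) (a : Fin m) (N : ℕ) : Input Q where
  rel b := if b = a then (Finset.range N).image (List.replicate (Q.arity b)) else ∅
  length_eq b t ht := by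
    split_ifs at ht with h
    · obtain ⟨i, -, rfl⟩ := Finset.mem_image.1 ht
      simp
    · simp at ht

theorem card_diagonalInput_rel (Q : Query n m) (a : Fin m) (N : ℕ) :
    ((diagonalInput Q a N).rel a).card = N := by
  have h : Q.arity a ≠ 0 := (List.length_pos_of_ne_nil (Q.vars_ne_nil a)).ne'
  simp [diagonalInput, Finset.card_image_of_injective _ (List.replicate_right_injective h)]

theorem size_diagonalInput (Q : Query n m) (a : Fin m) (N : ℕ) :
    (diagonalInput Q a N).size = N := by
  rw [Input.size, Finset.sum_eq_single a, card_diagonalInput_rel]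
  · intro b _ hb; simp [diagonalInput, hb]
  · simp

end BoxedRound

theorem mainTheorem5 {n m : ℕ} (hn : 0 < n) (Q : Query n m) (c : ℕ) (hc : 0 < c) :
    (∃ C : ℕ, ∀ (B M : ℕ) (I : Input Q), LargeMemory n m B M → I.size ≤ c * M →
      ∃ J : Input Q, J.IsSubinput I ∧
        boxedSteps B M I ≤ C * max (inMemorySteps J) I.size) ∧
    (∃ C : ℕ, ∀ N : ℕ, 1 ≤ N →
      boxedComplexity Q c N ≤ C * max (inMemoryComplexity Q N) N ∧
      max (inMemoryComplexity Q N) N ≤ C * boxedComplexity Q c N) := by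
  obtain ⟨C, hC⟩ := exists_boxedSteps_le Q c
  -- One constant serves both inequalities; the second needs only that it is at least 1.
  refine ⟨⟨C, hC⟩, C + 1, fun N _ => ⟨?_, ?_⟩⟩
  · refine iSup_le fun ⟨⟨I, B, M⟩, hI, hM, hIM⟩ => ?_
    obtain ⟨J, hJ, hle⟩ := hC B M I hM hIM
    have hJN : J.size ≤ N := (Finset.sum_le_sum fun a _ => Finset.card_le_card (hJ a)).trans hI
    have h1 : (inMemorySteps J : ℕ∞) ≤ inMemoryComplexity Q N :=
      le_iSup (fun I : {I : Input Q // I.size ≤ N} => (inMemorySteps I.1 : ℕ∞)) ⟨J, hJN⟩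
    calc (boxedSteps B M I : ℕ∞) ≤ ((C * max (inMemorySteps J) I.size : ℕ) : ℕ∞) := by
          exact_mod_cast hle
      _ = C * max (inMemorySteps J : ℕ∞) (I.size : ℕ∞) := by push_cast; rfl
      _ ≤ (C + 1 : ℕ) * max (inMemoryComplexity Q N) N := by
          gcongr
          omega
  · have hbox : ∀ (I : Input Q) (M : ℕ), I.size ≤ N → LargeMemory n m 1 M → I.size ≤ c * M →
        (boxedSteps 1 M I : ℕ∞) ≤ boxedComplexity Q c N := fun I M h1 h2 h3 =>
      le_iSup (fun p : {p : Input Q × ℕ × ℕ //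
        p.1.size ≤ N ∧ LargeMemory n m p.2.1 p.2.2 ∧ p.1.size ≤ c * p.2.2} =>
        (boxedSteps p.1.2.1 p.1.2.2 p.1.1 : ℕ∞)) ⟨(I, 1, M), h1, h2, h3⟩
    have hone : boxedComplexity Q c N ≤ ((C + 1 : ℕ) : ℕ∞) * boxedComplexity Q c N :=
      le_mul_of_one_le_left zero_le (by exact_mod_cast Nat.succ_le_succ (Nat.zero_le C))
    refine le_trans (max_le ?_ ?_) hone
    · refine iSup_le fun ⟨I, hI⟩ => ?_
      obtain ⟨M, h1, h2, h3, -⟩ := exists_le_boxedSteps hn hc I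
      exact (Nat.cast_le.2 h3).trans (hbox I M hI h1 h2)
    · obtain ⟨a, -⟩ := Q.covered ⟨0, hn⟩
      obtain ⟨M, h1, h2, -, h4⟩ := exists_le_boxedSteps hn hc (diagonalInput Q a N)
      have h5 := h4 a
      rw [card_diagonalInput_rel] at h5
      exact (Nat.cast_le.2 h5).trans (hbox _ M (size_diagonalInput Q a N).le h1 h2)
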